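/- Let $q$ be a prime power and let $V$ be a finite-dimensional vector space over $\mathrm{GF}(q)$. A $(v,g,k,\lambda)_q$-GDD on $V$, where $\dim V=v$, is a triple $(V,\mathcal G,\mathcal B)$ in which $\mathcal G$ is a partition of the set of $1$-dimensional subspaces of $V$ into $g$-dimensional subspaces (groups) and $\mathcal B$ is a collection of $k$-dimensional subspaces of $V$ (blocks, repetitions allowed) such that $\dim(B\cap G)\le 1$ for all $G\in\mathcal G$, $B\in\mathcal B$, and every $2$-dimensional subspace of $V$ not contained in any group is contained in exactly $\lambda$ blocks. It is simple if no block is repeated. It admits a group $\Gamma$ of invertible linear maps of $V$ as an automorphism group if every element of $\Gamma$ maps $\mathcal G$ onto $\mathcal G$ and $\mathcal B$ onto $\mathcal B$. Let $m,l,k$ be positive integers with $3\le k\le\min\{m+1,l\}$. Regard $V=\mathrm{GF}(q)^{ml}$ as an $m$-dimensional vector space over $\mathrm{GF}(q^l)$, and let $\mathcal G$ be the Desarguesian $l$-spread of $V$, that is, the set of $1$-dimensional $\mathrm{GF}(q^l)$-subspaces of $V$ regarded as $l$-dimensional $\mathrm{GF}(q)$-subspaces. Then there exist simple $(ml,l,k,\lambda)_q$-GDDs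 on $V$ with group set $\mathcal G$ admitting $\mathrm{GL}(m,q^l)$ as an automorphism group, for the following parameters: (i) for $k=3$, $$\lambda=w_{2,1}(q^2+q+1)(q^3-q)$$ for every integer $w_{2,1}$ with $0\le w_{2,1}\le\left\lfloor\frac{(q^{l-1}-1)(q^{l-2}-1)}{(q^3-1)(q^2-1)}\right\rfloor$; (ii) for $k=4,5,6$, $$\lambda=\frac{(q^k-1)(q^k-q)\prod_{j=2}^{k-2}(q^{ml}-q^{jl})}{(q^{\gcd(3,l)}-1)\prod_{j=3}^{k-1}(q^k-q^j)},$$ which is an integer. -/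

import Mathlib

open Module

/-- `(V, 𝒢, ℬ)` is a `q`-analog of a group divisible design with parameters `(v, g, k, lam)_q`,
where `q = |F|`. The blocks form a multiset, so repeated blocks are allowed. -/
structure IsQGDD {F V : Type*} [Field F] [AddCommGroup V] [Module F V] (v g k lam : ℕ)
    (𝒢 : Set (Submodule F V)) (ℬ : Multiset (Submodule F V)) : Prop where
  finrank_space : finrank F V = v
  finrank_group : ∀ G ∈ 𝒢, finrank F G = g
  group_ne_bot : ∀ G ∈ 𝒢, G ≠ ⊥
  /-- The groups partition the set of `1`-subspaces of `V`. -/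
  existsUnique_group : ∀ P : Submodule F V, finrank F P = 1 → ∃! G, G ∈ 𝒢 ∧ P ≤ G
  finrank_block : ∀ B ∈ ℬ, finrank F B = k
  finrank_inf_le_one : ∀ G ∈ 𝒢, ∀ B ∈ ℬ, finrank F (B ⊓ G : Submodule F V) ≤ 1
  /-- Every `2`-subspace in no group lies in exactly `lam` blocks, counted with multiplicity. -/
  card_blocks : ∀ T : Submodule F V, finrank F T = 2 → (∀ G ∈ 𝒢, ¬ T ≤ G) →
    open Classical in (ℬ.filter fun B => T ≤ B).card = lam

/-- The design with groups `𝒢` and blocks `ℬ` is simple: no block is repeated. -/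
def IsSimpleQGDD {F V : Type*} [Field F] [AddCommGroup V] [Module F V] (v g k lam : ℕ)
    (𝒢 : Set (Submodule F V)) (ℬ : Multiset (Submodule F V)) : Prop :=
  IsQGDD v g k lam 𝒢 ℬ ∧ ℬ.Nodup

/-- The Desarguesian spread: the `1`-dimensional `K`-subspaces of `V`, viewed as `F`-subspaces. -/
def desarguesianSpread (F K V : Type*) [Field F] [Field K] [Algebra F K] [AddCommGroup V]
    [Module F V] [Module K V] [IsScalarTower F K V] : Set (Submodule F V) :=
  {G | ∃ L : Submodule K V, finrank K L = 1 ∧ L.restrictScalars F = G}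

/-- An invertible `F`-linear map is an automorphism of `(V, 𝒢, ℬ)` if it maps the set of groups
onto itself and the multiset of blocks onto itself. -/
def IsQGDDAutomorphism {F V : Type*} [Field F] [AddCommGroup V] [Module F V]
    (𝒢 : Set (Submodule F V)) (ℬ : Multiset (Submodule F V)) (φ : V ≃ₗ[F] V) : Prop :=
  (fun W => W.map (φ : V →ₗ[F] V)) '' 𝒢 = 𝒢 ∧ ℬ.map (fun W => W.map (φ : V →ₗ[F] V)) = ℬ

/-- `(V, 𝒢, ℬ)` admits `GL(V/K)`, the group of all invertible `K`-linear maps of `V`, as an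
automorphism group. -/
def AdmitsGL (F K : Type*) {V : Type*} [Field F] [Field K] [Algebra F K] [AddCommGroup V]
    [Module F V] [Module K V] [IsScalarTower F K V]
    (𝒢 : Set (Submodule F V)) (ℬ : Multiset (Submodule F V)) : Prop :=
  ∀ φ : V ≃ₗ[K] V, IsQGDDAutomorphism 𝒢 ℬ (φ.restrictScalars F)

/-! A block is the `F`-span of a `k`-tuple `e` in `V` whose `K`-linear relations are exactly the
multiples of one vector `u`, where the coordinates of `u` span over `F` a 3-dimensional subspace of
`K` from a family `𝒮` stable under `Kˣ`. Rescaling `u` moves this span within its `Kˣ`-orbit, and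
changing the `F`-basis of the block does not move it at all (`IsRelationOf.change_basis`), so the
condition depends only on the block.

Rank 3 is what makes groups and blocks meet trivially: a `K`-relation between two vectors of a block
is a relation of `e` whose coordinates span at most two dimensions over `F`, hence is zero. So
`F`-independent pairs in a block are `K`-independent (`IsRelationOf.linearIndependent_pair`).

`GL(V/K)` permutes the blocks and is transitive on `K`-independent pairs, so the number of blocks
through such a pair is constant. Two double counts (`natCard_relationBlocks_mul`,
`natCard_relationBlocks_mem_mul`) show it is proportional to the size of `𝒮`
(`exists_isSimpleQGDD`).

It remains to choose `𝒮`. The `Kˣ`-orbit of a subspace has `(q^l - 1)/(q^d - 1)` elements, `d` being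
the degree of its field of multipliers. One orbit with `d = gcd(3, l)` gives (ii), and `w` orbits
with `d = 1` give (i). -/

open scoped Pointwise

/-! ### Counting independent tuples, and transitivity of the linear group -/

/-- The number of linearly independent `r`-tuples in an `n`-dimensional space over a field with
`q` elements. -/
def independentCount (q n r : ℕ) : ℕ := ∏ i ∈ Finset.range r, (q ^ n - q ^ i)

theorem natCard_linearIndependent {K V : Type*} [Field K] [Finite K] [AddCommGroup V] [Module K V]
    [Finite V] {r : ℕ} (hr : r ≤ finrank K V) :
    Nat.card {s : Fin r → V // LinearIndependent K s} =
      independentCount (Nat.card K) (finrank K V) r := by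
  have := Fintype.ofFinite K
  rw [card_linearIndependent hr, independentCount, Finset.prod_range, Nat.card_eq_fintype_card]

theorem independentCount_pos {q n r : ℕ} (hq : 1 < q) (hr : r ≤ n) :
    0 < independentCount q n r :=
  Finset.prod_pos fun _ hi => Nat.sub_pos_of_lt <|
    Nat.pow_lt_pow_right hq ((Finset.mem_range.1 hi).trans_le hr)

theorem cast_independentCount {q n r : ℕ} (hq : 1 < q) (hr : r ≤ n) :
    (independentCount q n r : ℚ) = ∏ i ∈ Finset.range r, ((q : ℚ) ^ n - (q : ℚ) ^ i) := by
  rw [independentCount, Nat.cast_prod]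
  refine Finset.prod_congr rfl fun i hi => ?_
  rw [Nat.cast_sub (Nat.pow_le_pow_right hq.le ((Finset.mem_range.1 hi).le.trans hr))]
  push_cast
  rfl

theorem natCard_eq_mul_of_fiber {α β : Type*} [Finite α] [Finite β] (f : α → β) {n : ℕ}
    (h : ∀ b, Nat.card {a // f a = b} = n) : Nat.card α = Nat.card β * n := by
  have := Fintype.ofFinite β
  rw [← Nat.card_congr (Equiv.sigmaFiberEquiv f), Nat.card_sigma,
    Finset.sum_congr rfl fun b _ => h b, Finset.sum_const, smul_eq_mul, Nat.card_eq_fintype_card]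
  rfl

/-- An isomorphism between two subspaces of a finite-dimensional space extends to the whole space.
For pairs this is the transitivity that makes the block count constant. -/
theorem exists_linearEquiv_comp_eq {ι K V : Type*} [Field K] [AddCommGroup V]
    [Module K V] [FiniteDimensional K V] {v w : ι → V} (hv : LinearIndependent K v)
    (hw : LinearIndependent K w) : ∃ φ : V ≃ₗ[K] V, ∀ i, φ (v i) = w i := by
  let e := hv.linearCombinationEquiv.symm ≪≫ₗ hw.linearCombinationEquiv
  obtain ⟨φ, hφ⟩ := Submodule.exists_linearEquiv_restrict_eq e
  refine ⟨φ, fun i => ?_⟩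
  have hmem : v i ∈ Submodule.span K (Set.range v) := Submodule.subset_span ⟨i, rfl⟩
  rw [show v i = ((⟨v i, hmem⟩ : Submodule.span K (Set.range v)) : V) from rfl, ← hφ]
  have h1 : hv.linearCombinationEquiv.symm ⟨v i, hmem⟩ = Finsupp.single i 1 :=
    hv.repr_eq_single i _ rfl
  change ((hw.linearCombinationEquiv (hv.linearCombinationEquiv.symm ⟨v i, hmem⟩) : _) : V) = w i
  rw [h1]
  simp

theorem finrank_units_smul {F K : Type*} [Field F] [Field K] [Algebra F K] (a : Kˣ)
    (S : Submodule F K) : finrank F (a • S : Submodule F K) = finrank F S :=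
  (LinearEquiv.finrank_eq (Submodule.equivMapOfInjective (DistribSMul.toLinearMap F K a)
    (MulAction.injective a) S)).symm

/-! ### Tuples with a one-dimensional space of relations -/

/-- The tuple `e` of vectors has exactly the `K`-linear relations that are multiples of `u`. -/
def IsRelationOf {K V : Type*} [Field K] [AddCommGroup V] [Module K V] {k : ℕ}
    (u : Fin k → K) (e : Fin k → V) : Prop :=
  LinearMap.ker (Fintype.linearCombination K e) = Submodule.span K {u}

section Relation

variable {F K V : Type*} [Field F] [Field K] [Algebra F K] [AddCommGroup V] [Module K V] {k : ℕ}

theorem IsRelationOf.sum_eq_zero_iff {u : Fin k → K} {e : Fin k → V} (h : IsRelationOf u e)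
    (c : Fin k → K) : ∑ i, c i • e i = 0 ↔ ∃ μ : K, μ • u = c := by
  rw [← Fintype.linearCombination_apply, ← LinearMap.mem_ker, h, Submodule.mem_span_singleton]

theorem isRelationOf_iff {u : Fin k → K} {e : Fin k → V} :
    IsRelationOf u e ↔ ∀ c : Fin k → K, ∑ i, c i • e i = 0 ↔ ∃ μ : K, μ • u = c := by
  refine ⟨fun h => h.sum_eq_zero_iff, fun h => ?_⟩
  ext c
  rw [LinearMap.mem_ker, Fintype.linearCombination_apply, Submodule.mem_span_singleton, h]

theorem IsRelationOf.exists_units_smul {u u' : Fin k → K} {e : Fin k → V} (h : IsRelationOf u e)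
    (h' : IsRelationOf u' e) : ∃ a : Kˣ, a • u = u' :=
  Submodule.span_singleton_eq_span_singleton.1 (h.symm.trans h')

theorem IsRelationOf.units_smul {u : Fin k → K} {e : Fin k → V} (h : IsRelationOf u e)
    (a : Kˣ) : IsRelationOf (a • u) e :=
  h.trans (Submodule.span_singleton_eq_span_singleton.2 ⟨a, rfl⟩)

theorem IsRelationOf.map {u : Fin k → K} {e : Fin k → V} (h : IsRelationOf u e)
    (φ : V ≃ₗ[K] V) : IsRelationOf u (φ ∘ e) := by
  rw [isRelationOf_iff] at h ⊢
  intro c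
  rw [← h c, ← φ.map_eq_zero_iff (x := ∑ i, c i • e i)]
  simp

theorem span_range_units_smul (a : Kˣ) (u : Fin k → K) :
    Submodule.span F (Set.range (a • u)) = a • Submodule.span F (Set.range u) := by
  rw [show a • Submodule.span F (Set.range u) =
    (Submodule.span F (Set.range u)).map (DistribSMul.toLinearMap F K a) from rfl,
    Submodule.map_span, ← Set.range_comp]
  rfl

/-- A nonzero relation is a nonzero multiple of `u`, and scaling by a unit preserves the `F`-rank of
the coordinates. -/
theorem IsRelationOf.eq_zero_of_finrank_lt {u : Fin k → K} {e : Fin k → V} (h : IsRelationOf u e)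
    {c : Fin k → K} (hc : ∑ i, c i • e i = 0)
    (hr : finrank F (Submodule.span F (Set.range c)) < finrank F (Submodule.span F (Set.range u))) :
    c = 0 := by
  obtain ⟨μ, rfl⟩ := (h.sum_eq_zero_iff c).1 hc
  by_contra hne
  have hμ : μ ≠ 0 := by rintro rfl; simp at hne
  have := span_range_units_smul (F := F) (Units.mk0 μ hμ) u
  rw [show Units.mk0 μ hμ • u = μ • u from rfl] at this
  rw [this, finrank_units_smul] at hr
  exact lt_irrefl _ hr

variable [Module F V] [IsScalarTower F K V]

/-- The coordinates `a i • c + b i • d` lie in the `F`-span of `c` and `d`, so this relation has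
rank at most 2, below the rank 3 of `u`. -/
theorem IsRelationOf.eq_zero_of_add {u : Fin k → K} {e : Fin k → V} (h : IsRelationOf u e)
    (hu : finrank F (Submodule.span F (Set.range u)) = 3) (a b : Fin k → F) (c d : K)
    (hab : c • ∑ i, a i • e i + d • ∑ i, b i • e i = 0) (i : Fin k) : a i • c + b i • d = 0 := by
  have key : (fun i => a i • c + b i • d) = 0 := by
    refine h.eq_zero_of_finrank_lt (F := F) ?_ ?_
    · rw [← hab, Finset.smul_sum, Finset.smul_sum, ← Finset.sum_add_distrib]
      refine Finset.sum_congr rfl fun i _ => ?_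
      rw [add_smul, smul_assoc, smul_assoc, smul_comm c (a i), smul_comm d (b i)]
    · rw [hu]
      have h1 : Submodule.span F (Set.range fun i => a i • c + b i • d) ≤
          Submodule.span F (Set.range ![c, d]) := by
        rw [Submodule.span_le]
        rintro _ ⟨i, rfl⟩
        exact add_mem (Submodule.smul_mem _ _ (Submodule.subset_span ⟨0, rfl⟩))
          (Submodule.smul_mem _ _ (Submodule.subset_span ⟨1, rfl⟩))
      have := FiniteDimensional.span_of_finite F (Set.finite_range ![c, d])
      have h2 := Submodule.finrank_mono h1
      have h3 := finrank_range_le_card (R := F) (![c, d])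
      rw [Fintype.card_fin] at h3
      exact (h2.trans h3).trans_lt (by norm_num)
  exact congrFun key i

/-- A tuple whose relations are the multiples of a vector of rank `3` is independent over `F`. -/
theorem IsRelationOf.linearIndependent {u : Fin k → K} {e : Fin k → V} (h : IsRelationOf u e)
    (hu : finrank F (Submodule.span F (Set.range u)) = 3) : LinearIndependent F e := by
  rw [Fintype.linearIndependent_iff]
  intro a ha i
  have := h.eq_zero_of_add hu a 0 1 0 (by simp [ha]) i
  simpa using this

/-- In a block, linear independence over `F` is the same as linear independence over `K`. -/
theorem IsRelationOf.linearIndependent_pair {u : Fin k → K} {e : Fin k → V}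
    (h : IsRelationOf u e) (hu : finrank F (Submodule.span F (Set.range u)) = 3) {v : Fin 2 → V}
    (hv : ∀ i, v i ∈ Submodule.span F (Set.range e)) (hli : LinearIndependent F v) :
    LinearIndependent K v := by
  obtain ⟨a, ha⟩ := Submodule.mem_span_range_iff_exists_fun F |>.1 (hv 0)
  obtain ⟨b, hb⟩ := Submodule.mem_span_range_iff_exists_fun F |>.1 (hv 1)
  have hz : ∀ x y : F, x • v 0 + y • v 1 = 0 → x = 0 ∧ y = 0 := by
    intro x y hxy
    have := Fintype.linearIndependent_iff.1 hli ![x, y] (by simpa [Fin.sum_univ_two] using hxy)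
    exact ⟨this 0, this 1⟩
  rw [Fintype.linearIndependent_iff]
  intro g hg
  rw [Fin.sum_univ_two, ← ha, ← hb] at hg
  have key := h.eq_zero_of_add hu a b _ _ hg
  have h1 : ∃ j, b j ≠ 0 := by
    by_contra! hb0
    exact one_ne_zero (hz 0 1 (by simp [← hb, hb0])).2
  obtain ⟨j, hj⟩ := h1
  -- The ratio of the two `K`-coefficients lies in `F`. If `g 0` were nonzero, dividing by it would
  -- leave an `F`-relation between `v 0` and `v 1`.
  have hd : g 1 = (-(b j)⁻¹ * a j) • g 0 := by
    rw [mul_smul, eq_neg_of_add_eq_zero_left (key j), smul_neg, neg_smul, neg_neg, smul_smul,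
      inv_mul_cancel₀ hj, one_smul]
  have h0 : g 0 = 0 := by
    by_contra hne
    have h2 : ∀ i, a i + b i * (-(b j)⁻¹ * a j) = 0 := by
      intro i
      have := key i
      rw [hd, smul_smul, ← add_smul] at this
      exact (smul_eq_zero.1 this).resolve_right hne
    refine one_ne_zero (hz 1 (-(b j)⁻¹ * a j) ?_).1
    rw [← ha, ← hb, one_smul, Finset.smul_sum, ← Finset.sum_add_distrib]
    refine Finset.sum_eq_zero fun i _ => ?_
    rw [smul_smul, ← add_smul, mul_comm, h2, zero_smul]
  have h1 : g 1 = 0 := by rw [hd, h0, smul_zero]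
  exact fun i => by fin_cases i <;> assumption

/-- If `e' = A e` and `e = B e'`, then `A` and `B` are mutually inverse over `F`, and relations
transform by the transpose of `B`. An invertible matrix over `F` does not change the `F`-span of the
coordinates. -/
theorem IsRelationOf.change_basis {u : Fin k → K} {e e' : Fin k → V} (h : IsRelationOf u e)
    (he : LinearIndependent F e) (he' : LinearIndependent F e')
    (hs : Submodule.span F (Set.range e') = Submodule.span F (Set.range e)) :
    ∃ u' : Fin k → K, IsRelationOf u' e' ∧
      Submodule.span F (Set.range u') = Submodule.span F (Set.range u) := by
  have h1 : ∀ i, ∃ a : Fin k → F, ∑ j, a j • e j = e' i := fun i =>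
    (Submodule.mem_span_range_iff_exists_fun F).1 (hs ▸ Submodule.subset_span ⟨i, rfl⟩)
  have h2 : ∀ i, ∃ a : Fin k → F, ∑ j, a j • e' j = e i := fun i =>
    (Submodule.mem_span_range_iff_exists_fun F).1 (hs ▸ Submodule.subset_span ⟨i, rfl⟩)
  choose A hA using h1
  choose B hB using h2
  -- Independence of `f` turns `f = C D f` into `C D = 1`; the conclusion is the transposed
  -- identity, applied to vectors over `K`.
  have comp : ∀ (f f' : Fin k → V) (C D : Fin k → Fin k → F), LinearIndependent F f →
      (∀ i, ∑ j, C i j • f' j = f i) → (∀ i, ∑ j, D i j • f j = f' i) →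
      ∀ (c : Fin k → K) (l : Fin k), ∑ j, D j l • ∑ i, C i j • c i = c l := by
    intro f f' C D hf hC hD c l
    have h3 : ∀ i l, ∑ j, C i j * D j l = if i = l then 1 else 0 := by
      intro i l
      have h4 := hC i
      simp_rw [← hD, Finset.smul_sum, smul_smul] at h4
      rw [Finset.sum_comm] at h4
      simp_rw [← Finset.sum_smul] at h4
      have h5 := Fintype.linearIndependent_iff.1 hf
        (fun l => ∑ j, C i j * D j l - if i = l then 1 else 0)
        (by simp [sub_smul, h4]) l
      exact sub_eq_zero.1 h5
    simp_rw [Finset.smul_sum, smul_smul]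
    rw [Finset.sum_comm]
    simp_rw [← Finset.sum_smul, mul_comm, h3]
    simp
  have hAB := comp e' e A B he' hA hB
  have hBA := comp e e' B A he hB hA
  refine ⟨fun i => ∑ j, B j i • u j, ?_, le_antisymm ?_ ?_⟩
  · rw [isRelationOf_iff]
    intro c
    have h6 : ∑ i, c i • e' i = ∑ j, (∑ i, A i j • c i) • e j := by
      simp_rw [← hA, Finset.smul_sum, Finset.sum_smul]
      rw [Finset.sum_comm]
      refine Finset.sum_congr rfl fun i _ => Finset.sum_congr rfl fun j _ => ?_
      rw [smul_assoc, smul_comm]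
    rw [h6, h.sum_eq_zero_iff]
    refine exists_congr fun μ => ⟨fun h7 => ?_, fun h7 => ?_⟩
    · ext l
      rw [← hAB c l, Pi.smul_apply, Finset.smul_sum]
      refine Finset.sum_congr rfl fun j _ => ?_
      rw [← congrFun h7 j, smul_comm, Pi.smul_apply]
    · subst h7
      ext l
      simp only [Pi.smul_apply]
      rw [← hBA u l, Finset.smul_sum]
      refine Finset.sum_congr rfl fun j _ => ?_
      rw [smul_comm]
  · rw [Submodule.span_le]
    rintro _ ⟨i, rfl⟩
    exact Submodule.sum_mem _ fun j _ => Submodule.smul_mem _ _ (Submodule.subset_span ⟨j, rfl⟩)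
  · rw [Submodule.span_le]
    rintro _ ⟨l, rfl⟩
    rw [← hBA u l]
    exact Submodule.sum_mem _ fun j _ => Submodule.smul_mem _ _ (Submodule.subset_span ⟨j, rfl⟩)

end Relation

/-! ### Counting tuples with prescribed relations or prescribed span -/

theorem LinearMap.linearIndependent_comp_basis_iff {ι K W V : Type*} [Field K]
    [AddCommGroup W] [Module K W] [AddCommGroup V] [Module K V] (b : Basis ι K W) (h : W →ₗ[K] V) :
    LinearIndependent K (h ∘ b) ↔ LinearMap.ker h = ⊥ := by
  refine ⟨fun hli => ?_, fun hk => b.linearIndependent.map' h hk⟩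
  rw [LinearMap.ker_eq_bot']
  intro w hw
  rw [← b.linearCombination_repr w, Finsupp.apply_linearCombination] at hw
  rw [← b.linearCombination_repr w, linearIndependent_iff.1 hli _ hw, map_zero]

/-- Linear maps with kernel `U` are injective linear maps on the quotient by `U`. -/
def LinearMap.kerEqEquiv {K W V : Type*} [Field K] [AddCommGroup W] [Module K W]
    [AddCommGroup V] [Module K V] (U : Submodule K W) :
    {g : W →ₗ[K] V // LinearMap.ker g = U} ≃ {h : (W ⧸ U) →ₗ[K] V // LinearMap.ker h = ⊥} where
  toFun g := ⟨U.liftQ g.1 g.2.ge, by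
    rw [Submodule.ker_liftQ, g.2, Submodule.mkQ_map_self]⟩
  invFun h := ⟨h.1 ∘ₗ U.mkQ, by
    rw [LinearMap.ker_comp, h.2, ← LinearMap.ker, Submodule.ker_mkQ]⟩
  left_inv g := by ext; simp
  right_inv h := by ext; simp

/-- Such tuples are the linear maps from `K^k` with kernel the line of `u`, that is, injective maps
from a quotient of dimension `k - 1`; on a basis these are independent `(k - 1)`-tuples. -/
theorem natCard_isRelationOf {K V : Type*} [Field K] [Finite K] [AddCommGroup V] [Module K V]
    [Finite V] {k : ℕ} {u : Fin k → K} (hu : u ≠ 0) (hk : k - 1 ≤ finrank K V) :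
    Nat.card {e : Fin k → V // IsRelationOf u e} =
      independentCount (Nat.card K) (finrank K V) (k - 1) := by
  have hfr : finrank K ((Fin k → K) ⧸ Submodule.span K {u}) = k - 1 := by
    have := (Submodule.span K {u}).finrank_quotient_add_finrank
    rw [finrank_span_singleton hu, finrank_fin_fun] at this
    omega
  let b := finBasisOfFinrankEq K _ hfr
  rw [← natCard_linearIndependent hk]
  refine Nat.card_congr (((Pi.basisFun K (Fin k)).constr K).toEquiv.subtypeEquiv ?_ |>.trans <|
    (LinearMap.kerEqEquiv (V := V) (Submodule.span K {u})).trans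
    ((b.constr K).symm.toEquiv.subtypeEquiv ?_))
  · intro e
    have hc : (Pi.basisFun K (Fin k)).constr K e = Fintype.linearCombination K e := by
      ext
      simp
    rw [IsRelationOf, ← hc]
    rfl
  · intro h
    exact (LinearMap.linearIndependent_comp_basis_iff b h).symm

theorem Matrix.span_range_col_eq_top_iff {F : Type*} [Field F] {r k : ℕ}
    (M : Matrix (Fin r) (Fin k) F) :
    Submodule.span F (Set.range M.col) = ⊤ ↔ LinearIndependent F M.row := by
  rw [linearIndependent_iff_card_eq_finrank_span, Set.finrank, ← Matrix.rank_eq_finrank_span_row,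
    Matrix.rank_eq_finrank_span_cols, Fintype.card_fin]
  constructor
  · intro h
    rw [h, finrank_top, finrank_fin_fun]
  · intro h
    apply Submodule.eq_top_of_finrank_eq
    rw [← h, finrank_fin_fun]

/-- In coordinates on `S`, the tuple is an `r × k` matrix. Its columns span exactly when its rows
are independent, so one counts independent `r`-tuples in `F^k`. -/
theorem natCard_span_range_eq {F W : Type*} [Field F] [Finite F] [AddCommGroup W] [Module F W]
    {k r : ℕ} (hr : r ≤ k) (S : Submodule F W) [FiniteDimensional F S] (hS : finrank F S = r) :
    Nat.card {u : Fin k → W // Submodule.span F (Set.range u) = S} =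
      independentCount (Nat.card F) k r := by
  let s := finBasisOfFinrankEq F S hS
  let g : (Fin r → F) →ₗ[F] W := S.subtype ∘ₗ s.equivFun.symm.toLinearMap
  have hg : Function.Injective g := S.injective_subtype.comp s.equivFun.symm.injective
  have hrange : (⊤ : Submodule F (Fin r → F)).map g = S := by
    simp [g]
  have hiff : ∀ M : Fin r → Fin k → F, LinearIndependent F M ↔
      Submodule.span F (Set.range fun i => g fun j => M j i) = S := by
    intro M
    have h := Matrix.span_range_col_eq_top_iff (Matrix.of M)
    rw [show (Matrix.of M).row = M from rfl] at h
    rw [← h, ← (Submodule.map_injective_of_injective hg).eq_iff, hrange, Submodule.map_span,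
      ← Set.range_comp]
    rfl
  have h := natCard_linearIndependent (K := F) (V := Fin k → F) (r := r) (by simpa using hr)
  rw [finrank_fin_fun] at h
  rw [← h]
  symm
  refine Nat.card_congr (Equiv.ofBijective
    (fun M => ⟨fun i => g fun j => M.1 j i, (hiff M.1).1 M.2⟩) ⟨?_, ?_⟩)
  · rintro ⟨M, hM⟩ ⟨M', hM'⟩ h
    rw [Subtype.mk.injEq] at h ⊢
    ext j i
    exact congrFun (hg (congrFun h i)) j
  · rintro ⟨u, hu⟩
    have : ∀ i, ∃ x, g x = u i := by
      intro i
      have h1 : u i ∈ S := hu ▸ Submodule.subset_span ⟨i, rfl⟩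
      rw [← hrange] at h1
      obtain ⟨x, -, hx⟩ := h1
      exact ⟨x, hx⟩
    choose x hx using this
    have hx' : (fun i => g fun j => x i j) = u := funext hx
    exact ⟨⟨fun j i => x i j, (hiff _).2 (by rw [hx', hu])⟩, Subtype.ext hx'⟩

theorem natCard_linearIndependent_mem {F V : Type*} [Field F] [Finite F] [AddCommGroup V]
    [Module F V] [Finite V] (B : Submodule F V) {r : ℕ} (hr : r ≤ finrank F B) :
    Nat.card {v : Fin r → V // LinearIndependent F v ∧ ∀ i, v i ∈ B} =
      independentCount (Nat.card F) (finrank F B) r := by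
  rw [← natCard_linearIndependent hr]
  have hli : ∀ s : Fin r → B, LinearIndependent F (fun i => (s i : V)) ↔ LinearIndependent F s :=
    fun s => LinearMap.linearIndependent_iff B.subtype B.ker_subtype
  exact Nat.card_congr
    { toFun := fun v => ⟨fun i => ⟨v.1 i, v.2.2 i⟩, (hli _).1 v.2.1⟩
      invFun := fun s => ⟨fun i => s.1 i, (hli _).2 s.2, fun i => (s.1 i).2⟩
      left_inv := fun _ => rfl
      right_inv := fun _ => rfl }

/-! ### Blocks and their double counts -/

/-- The spans of the `k`-tuples in `V` whose relations over `K` are the multiples of a vector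
with coordinate span in `𝒮`. -/
def relationBlocks {F K : Type*} (V : Type*) [Field F] [Field K] [Algebra F K] [AddCommGroup V]
    [Module F V] [Module K V] (𝒮 : Set (Submodule F K)) (k : ℕ) : Set (Submodule F V) :=
  {B | ∃ (e : Fin k → V) (u : Fin k → K), IsRelationOf u e ∧
    Submodule.span F (Set.range u) ∈ 𝒮 ∧ Submodule.span F (Set.range e) = B}

section Blocks

variable {F K V : Type*} [Field F] [Field K] [Algebra F K] [AddCommGroup V] [Module K V] {k : ℕ}
    {𝒮 : Set (Submodule F K)}

theorem natCard_relation_pairs [Finite F] [Finite K] [Finite V]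
    (h3 : ∀ S ∈ 𝒮, finrank F S = 3) (hk : 3 ≤ k) (hkm : k - 1 ≤ finrank K V) :
    Nat.card {p : (Fin k → V) × (Fin k → K) //
      IsRelationOf p.2 p.1 ∧ Submodule.span F (Set.range p.2) ∈ 𝒮} =
    Nat.card 𝒮 * independentCount (Nat.card F) k 3 *
      independentCount (Nat.card K) (finrank K V) (k - 1) := by
  have : Finite (Submodule F K) := Finite.of_injective _ SetLike.coe_injective
  have h1 : Nat.card {u : Fin k → K // Submodule.span F (Set.range u) ∈ 𝒮} =
      Nat.card 𝒮 * independentCount (Nat.card F) k 3 := by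
    refine natCard_eq_mul_of_fiber (fun u => (⟨_, u.2⟩ : 𝒮)) fun S => ?_
    rw [← natCard_span_range_eq hk S.1 (h3 _ S.2)]
    exact Nat.card_congr
      { toFun := fun u => ⟨u.1.1, congrArg Subtype.val u.2⟩
        invFun := fun u => ⟨⟨u.1, by rw [u.2]; exact S.2⟩, Subtype.ext u.2⟩
        left_inv := fun _ => rfl
        right_inv := fun _ => rfl }
  rw [← h1]
  refine natCard_eq_mul_of_fiber
    (fun p => (⟨p.1.2, p.2.2⟩ : {u : Fin k → K // Submodule.span F (Set.range u) ∈ 𝒮})) fun u => ?_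
  have hu : u.1 ≠ 0 := by
    intro h0
    have h4 := h3 _ u.2
    have : Submodule.span F (Set.range u.1) = ⊥ := by
      rw [h0, Submodule.span_eq_bot]
      rintro _ ⟨i, rfl⟩
      rfl
    rw [this, finrank_bot] at h4
    omega
  rw [← natCard_isRelationOf hu hkm]
  exact Nat.card_congr
    { toFun := fun p => ⟨p.1.1.1, by
        have h := p.1.2.1
        rwa [show p.1.1.2 = u.1 from congrArg Subtype.val p.2] at h⟩
      invFun := fun e => ⟨⟨(e.1, u.1), e.2, u.2⟩, rfl⟩
      left_inv := by
        rintro ⟨⟨⟨e, u'⟩, h⟩, rfl⟩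
        rfl
      right_inv := fun _ => rfl }

variable [Module F V] [IsScalarTower F K V]

theorem finrank_of_mem_relationBlocks (h3 : ∀ S ∈ 𝒮, finrank F S = 3) {B : Submodule F V}
    (hB : B ∈ relationBlocks V 𝒮 k) : finrank F B = k := by
  obtain ⟨e, u, h, hu, rfl⟩ := hB
  rw [finrank_span_eq_card (h.linearIndependent (h3 _ hu)), Fintype.card_fin]

/-- Every basis of a block witnesses that it is a block, so each block arises from all of its
ordered bases. -/
theorem exists_isRelationOf_of_mem_relationBlocks (h3 : ∀ S ∈ 𝒮, finrank F S = 3)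
    {B : Submodule F V} (hB : B ∈ relationBlocks V 𝒮 k) {e : Fin k → V}
    (he : LinearIndependent F e) (heB : Submodule.span F (Set.range e) = B) :
    ∃ u : Fin k → K, IsRelationOf u e ∧ Submodule.span F (Set.range u) ∈ 𝒮 := by
  obtain ⟨e', u, h, hu, rfl⟩ := hB
  obtain ⟨u', h', hu'⟩ := h.change_basis (h.linearIndependent (h3 _ hu)) he heB
  exact ⟨u', h', hu' ▸ hu⟩

theorem linearIndependent_pair_of_mem_relationBlocks (h3 : ∀ S ∈ 𝒮, finrank F S = 3)
    {B : Submodule F V} (hB : B ∈ relationBlocks V 𝒮 k) {v : Fin 2 → V} (hv : ∀ i, v i ∈ B)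
    (hli : LinearIndependent F v) : LinearIndependent K v := by
  obtain ⟨e', u, h, hu, rfl⟩ := hB
  exact h.linearIndependent_pair (h3 _ hu) hv hli

theorem map_mem_relationBlocks {B : Submodule F V} (hB : B ∈ relationBlocks V 𝒮 k)
    (φ : V ≃ₗ[K] V) :
    B.map (φ.restrictScalars F : V →ₗ[F] V) ∈ relationBlocks V 𝒮 k := by
  obtain ⟨e, u, h, hu, rfl⟩ := hB
  refine ⟨φ ∘ e, u, h.map φ, hu, ?_⟩
  rw [Submodule.map_span, ← Set.range_comp]
  rfl

variable [Finite V]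

theorem natCard_relationBlocks_mem_eq (v w : Fin 2 → V) (hv : LinearIndependent K v)
    (hw : LinearIndependent K w) :
    Nat.card {B : relationBlocks V 𝒮 k // ∀ i, v i ∈ B.1} =
      Nat.card {B : relationBlocks V 𝒮 k // ∀ i, w i ∈ B.1} := by
  have : Finite (Submodule F V) := Finite.of_injective _ SetLike.coe_injective
  have key : ∀ v w : Fin 2 → V, LinearIndependent K v → LinearIndependent K w →
      Nat.card {B : relationBlocks V 𝒮 k // ∀ i, v i ∈ B.1} ≤
      Nat.card {B : relationBlocks V 𝒮 k // ∀ i, w i ∈ B.1} := by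
    intro v w hv hw
    obtain ⟨φ, hφ⟩ := exists_linearEquiv_comp_eq hv hw
    refine Nat.card_le_card_of_injective
      (fun B => ⟨⟨_, map_mem_relationBlocks B.1.2 φ⟩, fun i => ⟨v i, B.2 i, hφ i⟩⟩) ?_
    intro B B' h
    have h1 := congrArg (fun B => B.1.1) h
    exact Subtype.ext (Subtype.ext
      (Submodule.map_injective_of_injective (φ.restrictScalars F).injective h1))
  exact (key v w hv hw).antisymm (key w v hw hv)

variable [Finite F] [Finite K]

/-- Pairs `(e, u)` are counted in two ways: by choosing `u` first, or by choosing a block, an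
ordered basis `e` of it, and then one of the `|K| - 1` multiples of its relation. Stability of `𝒮`
under `Kˣ` makes all these multiples admissible. -/
theorem natCard_relationBlocks_mul (h3 : ∀ S ∈ 𝒮, finrank F S = 3)
    (hs : ∀ (a : Kˣ), ∀ S ∈ 𝒮, a • S ∈ 𝒮) (hk : 3 ≤ k) (hkm : k - 1 ≤ finrank K V) :
    Nat.card (relationBlocks V 𝒮 k) * independentCount (Nat.card F) k k * (Nat.card K - 1) =
    Nat.card 𝒮 * independentCount (Nat.card F) k 3 *
      independentCount (Nat.card K) (finrank K V) (k - 1) := by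
  have : Finite (Submodule F V) := Finite.of_injective _ SetLike.coe_injective
  rw [← natCard_relation_pairs h3 hk hkm]
  have h1 : Nat.card {e : Fin k → V // ∃ u : Fin k → K, IsRelationOf u e ∧
      Submodule.span F (Set.range u) ∈ 𝒮} =
      Nat.card (relationBlocks V 𝒮 k) * independentCount (Nat.card F) k k := by
    refine natCard_eq_mul_of_fiber
      (fun e => (⟨Submodule.span F (Set.range e.1), by
        obtain ⟨u, h, hu⟩ := e.2
        exact ⟨e.1, u, h, hu, rfl⟩⟩ : relationBlocks V 𝒮 k)) fun B => ?_
    have hBk := finrank_of_mem_relationBlocks h3 B.2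
    have h2 := natCard_linearIndependent_mem B.1 (r := k) hBk.ge
    rw [hBk] at h2
    rw [← h2]
    have hspan : ∀ e : Fin k → V, LinearIndependent F e → (∀ i, e i ∈ B.1) →
        Submodule.span F (Set.range e) = B.1 := by
      intro e he heB
      refine Submodule.eq_of_le_of_finrank_eq
        (Submodule.span_le.2 (by rintro _ ⟨i, rfl⟩; exact heB i)) ?_
      rw [hBk, finrank_span_eq_card he, Fintype.card_fin]
    exact Nat.card_congr
      { toFun := fun e => ⟨e.1.1, by
          obtain ⟨u, h, hu⟩ := e.1.2
          exact h.linearIndependent (h3 _ hu), fun i =>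
            congrArg Subtype.val e.2 ▸ Submodule.subset_span ⟨i, rfl⟩⟩
        invFun := fun e => ⟨⟨e.1, exists_isRelationOf_of_mem_relationBlocks h3 B.2 e.2.1
          (hspan _ e.2.1 e.2.2)⟩, Subtype.ext (hspan _ e.2.1 e.2.2)⟩
        left_inv := fun _ => rfl
        right_inv := fun _ => rfl }
  rw [← h1]
  symm
  refine natCard_eq_mul_of_fiber
    (fun p => (⟨p.1.1, p.1.2, p.2⟩ : {e : Fin k → V // ∃ u : Fin k → K, IsRelationOf u e ∧
      Submodule.span F (Set.range u) ∈ 𝒮})) fun e => ?_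
  obtain ⟨e, u, h, hu⟩ := e
  rw [← Nat.card_units]
  symm
  have hne : ∃ i, u i ≠ 0 := by
    by_contra! h0
    have h4 := h3 _ hu
    have : Submodule.span F (Set.range u) = ⊥ := by
      rw [Submodule.span_eq_bot]
      rintro _ ⟨i, rfl⟩
      exact h0 i
    rw [this, finrank_bot] at h4
    omega
  refine Nat.card_congr (Equiv.ofBijective
    (fun a => ⟨⟨(e, a • u), h.units_smul a, by
      rw [span_range_units_smul]; exact hs a _ hu⟩, rfl⟩) ⟨?_, ?_⟩)
  · intro a b hab
    have h5 : a • u = b • u := congrArg (fun p => p.1.1.2) hab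
    obtain ⟨i, hi⟩ := hne
    exact Units.ext (mul_right_cancel₀ hi (congrFun h5 i))
  · rintro ⟨⟨⟨e', u'⟩, h', hu'⟩, he⟩
    obtain rfl : e' = e := congrArg Subtype.val he
    obtain ⟨a, rfl⟩ := h.exists_units_smul h'
    exact ⟨a, rfl⟩

/-- Incidences of `K`-independent pairs with blocks are counted from both sides. Inside a block
these pairs are just the `F`-independent ones. -/
theorem natCard_relationBlocks_mem_mul (h3 : ∀ S ∈ 𝒮, finrank F S = 3) (hk : 2 ≤ k)
    (hm : 2 ≤ finrank K V) (v : Fin 2 → V) (hv : LinearIndependent K v) :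
    Nat.card {B : relationBlocks V 𝒮 k // ∀ i, v i ∈ B.1} *
      independentCount (Nat.card K) (finrank K V) 2 =
    Nat.card (relationBlocks V 𝒮 k) * independentCount (Nat.card F) k 2 := by
  have : Finite (Submodule F V) := Finite.of_injective _ SetLike.coe_injective
  let P := {p : (Fin 2 → V) × relationBlocks V 𝒮 k // LinearIndependent K p.1 ∧
    ∀ i, p.1 i ∈ p.2.1}
  rw [mul_comm, ← natCard_linearIndependent hm]
  trans Nat.card P
  · symm
    refine natCard_eq_mul_of_fiber
      (fun p : P => (⟨p.1.1, p.2.1⟩ : {s : Fin 2 → V // LinearIndependent K s})) fun w => ?_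
    rw [natCard_relationBlocks_mem_eq v w.1 hv w.2]
    exact Nat.card_congr
      { toFun := fun p => ⟨p.1.1.2, by
          have h := p.1.2.2
          rwa [show p.1.1.1 = w.1 from congrArg Subtype.val p.2] at h⟩
        invFun := fun B => ⟨⟨(w.1, B.1), w.2, B.2⟩, rfl⟩
        left_inv := by
          rintro ⟨⟨⟨e, u'⟩, h⟩, rfl⟩
          rfl
        right_inv := fun _ => rfl }
  · refine natCard_eq_mul_of_fiber (fun p : P => p.1.2) fun B => ?_
    have hBk := finrank_of_mem_relationBlocks h3 B.2
    have h2 := natCard_linearIndependent_mem B.1 (r := 2) (hk.trans_eq hBk.symm)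
    rw [hBk] at h2
    rw [← h2]
    exact Nat.card_congr
      { toFun := fun p => ⟨p.1.1.1, p.1.2.1.restrict_scalars' F, by
          have h := p.1.2.2
          rwa [show p.1.1.2 = B from p.2] at h⟩
        invFun := fun w => ⟨⟨(w.1, B),
          linearIndependent_pair_of_mem_relationBlocks h3 B.2 w.2.2 w.2.1, w.2.2⟩, rfl⟩
        left_inv := by
          rintro ⟨⟨⟨e, u'⟩, h⟩, rfl⟩
          rfl
        right_inv := fun _ => rfl }

end Blocks

/-! ### The design on the Desarguesian spread -/

section Design

variable {F K V : Type*} [Field F] [Field K] [Algebra F K] [AddCommGroup V]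
    [Module F V] [Module K V] [IsScalarTower F K V]

theorem existsUnique_mem_desarguesianSpread (P : Submodule F V) (hP : finrank F P = 1) :
    ∃! G, G ∈ desarguesianSpread F K V ∧ P ≤ G := by
  obtain ⟨x, hx0, hx⟩ := finrank_eq_one_iff'.1 hP
  have hx0' : (x : V) ≠ 0 := by simpa using hx0
  refine ⟨(Submodule.span K {(x : V)}).restrictScalars F,
    ⟨⟨_, finrank_span_singleton hx0', rfl⟩, ?_⟩, ?_⟩
  · intro y hy
    obtain ⟨c, hc⟩ := hx ⟨y, hy⟩
    have hc' : c • (x : V) = y := congrArg Subtype.val hc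
    rw [← hc']
    exact Submodule.smul_mem _ c (Submodule.mem_span_singleton_self (x : V))
  · rintro _ ⟨⟨L, hL, rfl⟩, hPL⟩
    have : FiniteDimensional K L := Module.finite_of_finrank_pos (by omega)
    congr 1
    symm
    apply Submodule.eq_of_le_of_finrank_eq
    · rw [Submodule.span_singleton_le_iff_mem]
      exact hPL x.2
    · rw [hL, finrank_span_singleton hx0']

theorem linearIndependent_of_not_le_group {T : Submodule F V}
    (hTG : ∀ G ∈ desarguesianSpread F K V, ¬ T ≤ G) {v : Fin 2 → V}
    (hv : LinearIndependent F v) (hvT : Submodule.span F (Set.range v) = T) :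
    LinearIndependent K v := by
  have h0 : v 0 ≠ 0 := hv.ne_zero 0
  have hv' : v = ![v 0, v 1] := by
    ext i
    fin_cases i <;> rfl
  by_contra h
  rw [hv', LinearIndependent.pair_iff' h0] at h
  push Not at h
  obtain ⟨a, ha⟩ := h
  refine hTG _ ⟨Submodule.span K {v 0}, finrank_span_singleton h0, rfl⟩ ?_
  rw [← hvT, Submodule.span_le]
  rintro _ ⟨i, rfl⟩
  fin_cases i
  · exact Submodule.mem_span_singleton_self (v 0)
  · exact Submodule.mem_span_singleton.2 ⟨a, ha⟩

theorem image_desarguesianSpread (φ : V ≃ₗ[K] V) :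
    (fun W => W.map (φ.restrictScalars F : V →ₗ[F] V)) '' desarguesianSpread F K V =
      desarguesianSpread F K V := by
  have key : ∀ ψ : V ≃ₗ[K] V, ∀ G ∈ desarguesianSpread F K V,
      G.map (ψ.restrictScalars F : V →ₗ[F] V) ∈ desarguesianSpread F K V := by
    rintro ψ _ ⟨L, hL, rfl⟩
    exact ⟨L.map (ψ : V →ₗ[K] V), by rw [LinearEquiv.finrank_map_eq, hL], rfl⟩
  refine Set.Subset.antisymm ?_ ?_
  · rintro _ ⟨G, hG, rfl⟩
    exact key φ G hG
  · intro G hG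
    refine ⟨_, key φ.symm G hG, ?_⟩
    ext x
    simp [Submodule.mem_map]

variable {k l m : ℕ} {𝒮 : Set (Submodule F K)}

/-- Two `F`-independent vectors in the intersection would be `K`-independent inside a `K`-line. -/
theorem finrank_inf_le_one_of_mem_relationBlocks [FiniteDimensional F V]
    (h3 : ∀ S ∈ 𝒮, finrank F S = 3)
    {G B : Submodule F V} (hG : G ∈ desarguesianSpread F K V) (hB : B ∈ relationBlocks V 𝒮 k) :
    finrank F (B ⊓ G : Submodule F V) ≤ 1 := by
  by_contra! h
  obtain ⟨L, hL, rfl⟩ := hG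
  have : FiniteDimensional K L := Module.finite_of_finrank_pos (by omega)
  obtain ⟨v, hv⟩ := exists_linearIndependent_of_le_finrank (show 2 ≤ _ from h)
  have hv' : LinearIndependent F (fun i => (v i : V)) :=
    hv.map' (Submodule.subtype _) (Submodule.ker_subtype _)
  have hK := linearIndependent_pair_of_mem_relationBlocks h3 hB (fun i => (v i).2.1) hv'
  have hLi : LinearIndependent K (fun i => (⟨v i, (v i).2.2⟩ : L)) :=
    (LinearMap.linearIndependent_iff L.subtype L.ker_subtype).1 hK
  have := hLi.fintype_card_le_finrank
  rw [hL, Fintype.card_fin] at this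
  omega

theorem card_blocks_eq [Finite V] (ℬ : Finset (Submodule F V))
    (hℬ : ∀ B, B ∈ ℬ ↔ B ∈ relationBlocks V 𝒮 k) {T : Submodule F V} (hT : finrank F T = 2)
    (hTG : ∀ G ∈ desarguesianSpread F K V, ¬ T ≤ G) {v₀ : Fin 2 → V}
    (hv₀ : LinearIndependent K v₀) :
    open Classical in (ℬ.val.filter fun B => T ≤ B).card =
      Nat.card {B : relationBlocks V 𝒮 k // ∀ i, v₀ i ∈ B.1} := by
  classical
  have : FiniteDimensional F T := Module.finite_of_finrank_pos (by omega)
  let b := finBasisOfFinrankEq F T hT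
  let v : Fin 2 → V := fun i => b i
  have hv : LinearIndependent F v := b.linearIndependent.map' T.subtype T.ker_subtype
  have hvT : Submodule.span F (Set.range v) = T := by
    have h := congrArg (Submodule.map T.subtype) b.span_eq
    rw [Submodule.map_span, ← Set.range_comp, Submodule.map_top, Submodule.range_subtype] at h
    exact h
  have hvK := linearIndependent_of_not_le_group hTG hv hvT
  rw [natCard_relationBlocks_mem_eq v₀ v hv₀ hvK]
  have hTB : ∀ B : Submodule F V, T ≤ B ↔ ∀ i, v i ∈ B := by
    intro B
    rw [← hvT, Submodule.span_le, Set.range_subset_iff]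
    rfl
  rw [← Finset.filter_val, ← Finset.card_def,
    ← Nat.subtype_card (p := fun B => B ∈ relationBlocks V 𝒮 k ∧ ∀ i, v i ∈ B) _
      (fun B => by rw [Finset.mem_filter, hℬ, hTB])]
  exact (Nat.card_congr (Equiv.subtypeSubtypeEquivSubtypeInter _ _)).symm

theorem exists_isSimpleQGDD [Finite F] [Finite K] [Finite V] (hl : finrank F K = l)
    (hm : finrank K V = m) (h3 : ∀ S ∈ 𝒮, finrank F S = 3) (hs : ∀ a : Kˣ, ∀ S ∈ 𝒮, a • S ∈ 𝒮)
    (hk : 3 ≤ k) (hkm : k - 1 ≤ m) :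
    ∃ lam : ℕ, (lam : ℚ) = Nat.card 𝒮 / ((Nat.card F : ℚ) ^ l - 1) *
        ((((Nat.card F : ℚ) ^ k - 1) * ((Nat.card F : ℚ) ^ k - Nat.card F) *
          ∏ j ∈ Finset.Icc 2 (k - 2), ((Nat.card F : ℚ) ^ (m * l) - (Nat.card F : ℚ) ^ (j * l))) /
          ∏ j ∈ Finset.Icc 3 (k - 1), ((Nat.card F : ℚ) ^ k - (Nat.card F : ℚ) ^ j)) ∧
      ∃ ℬ : Multiset (Submodule F V),
        IsSimpleQGDD (m * l) l k lam (desarguesianSpread F K V) ℬ ∧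
        AdmitsGL F K (desarguesianSpread F K V) ℬ := by
  classical
  have : Finite (Submodule F V) := Finite.of_injective _ SetLike.coe_injective
  obtain ⟨v₀, hv₀⟩ := exists_linearIndependent_of_le_finrank (R := K) (M := V) (n := 2) (by omega)
  refine ⟨Nat.card {B : relationBlocks V 𝒮 k // ∀ i, v₀ i ∈ B.1}, ?_,
    (relationBlocks V 𝒮 k).toFinite.toFinset.val, ⟨⟨?_, ?_, ?_, ?_, ?_, ?_, ?_⟩, ?_⟩, ?_⟩
  · have h1 := natCard_relationBlocks_mul (V := V) h3 hs hk (by omega)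
    have h2 := natCard_relationBlocks_mem_mul (k := k) h3 (by omega) (by omega) v₀ hv₀
    generalize Nat.card {B : relationBlocks V 𝒮 k // ∀ i, v₀ i ∈ B.1} = lam at *
    generalize Nat.card (relationBlocks V 𝒮 k) = N at *
    generalize Nat.card 𝒮 = s at *
    have hQ : Nat.card K = Nat.card F ^ l := by rw [← hl, Module.natCard_eq_pow_finrank (K := F)]
    have hq : 1 < Nat.card F := Finite.one_lt_card
    have hQ1 : 1 < Nat.card K := Finite.one_lt_card
    rw [hm] at h1 h2
    have c1 := independentCount_pos hQ1 (show 2 ≤ m by omega)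
    have c2 := independentCount_pos hq (show 3 ≤ k from hk)
    have d1 := cast_independentCount hq (le_refl k)
    have d2 := cast_independentCount hq hk
    have d3 := cast_independentCount hq (show 2 ≤ k by omega)
    have d4 := cast_independentCount hQ1 (show 2 ≤ m by omega)
    have d5 := cast_independentCount hQ1 hkm
    have c3 := independentCount_pos hq (le_refl k)
    rw [← Finset.prod_range_mul_prod_Ico _ hk, ← d2] at d1
    rw [← Finset.prod_range_mul_prod_Ico _ (show 2 ≤ k - 1 by omega), ← d4] at d5
    have e1 : Finset.Icc 2 (k - 2) = Finset.Ico 2 (k - 1) := by ext; simp; omega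
    have e2 : Finset.Icc 3 (k - 1) = Finset.Ico 3 k := by ext; simp; omega
    have e3 : ∀ j, (Nat.card F : ℚ) ^ (j * l) = (Nat.card K : ℚ) ^ j := by
      intro j
      rw [hQ, mul_comm, pow_mul]
      norm_cast
    rw [e1, e2]
    simp_rw [e3]
    have e4 : (Nat.card F : ℚ) ^ l = Nat.card K := by rw [hQ]; norm_cast
    rw [e4]
    have h1' : (N : ℚ) * independentCount (Nat.card F) k k * (Nat.card K - 1) =
        s * independentCount (Nat.card F) k 3 * independentCount (Nat.card K) m (k - 1) := by
      have := congrArg (Nat.cast : ℕ → ℚ) h1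
      push_cast [Nat.cast_sub hQ1.le] at this
      exact this
    have h2' : (lam : ℚ) * independentCount (Nat.card K) m 2 =
        N * independentCount (Nat.card F) k 2 := mod_cast h2
    rw [d1, d5] at h1'
    rw [d3] at h2'
    have hQ1' : (Nat.card K : ℚ) - 1 ≠ 0 := by
      have : (1 : ℚ) < Nat.card K := mod_cast hQ1
      linarith
    have c1' : (independentCount (Nat.card K) m 2 : ℚ) ≠ 0 := mod_cast c1.ne'
    have c2' : (independentCount (Nat.card F) k 3 : ℚ) ≠ 0 := mod_cast c2.ne'
    have c3' : (independentCount (Nat.card F) k k : ℚ) ≠ 0 := mod_cast c3.ne'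
    rw [d1] at c3'
    have c4' := right_ne_zero_of_mul c3'
    simp only [Finset.prod_range_succ, Finset.prod_range_zero, pow_zero, pow_one, one_mul] at h2'
    generalize ∏ j ∈ Finset.Ico 3 k, ((Nat.card F : ℚ) ^ k - (Nat.card F : ℚ) ^ j) = A at *
    generalize ∏ j ∈ Finset.Ico 2 (k - 1), ((Nat.card K : ℚ) ^ m - (Nat.card K : ℚ) ^ j) = B at *
    generalize (independentCount (Nat.card K) m 2 : ℚ) = X at *
    generalize (independentCount (Nat.card F) k 3 : ℚ) = Y at *
    generalize ((Nat.card F : ℚ) ^ k - 1) * ((Nat.card F : ℚ) ^ k - Nat.card F) = Z at *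
    -- The first three factors of the basis count for a block cancel against the count of the
    -- vectors `u`; this leaves only the factors with index from 3 on.
    have h1'' : (N : ℚ) * A * (Nat.card K - 1) = s * X * B := by
      apply mul_left_cancel₀ c2'
      linear_combination h1'
    have : (lam : ℚ) * ((Nat.card K - 1) * A) = s * (Z * B) := by
      apply mul_left_cancel₀ c1'
      linear_combination (Nat.card K - 1 : ℚ) * A * h2' + Z * h1''
    field_simp
    linear_combination this
  · rw [← finrank_mul_finrank F K V, hl, hm, mul_comm]
  · rintro _ ⟨L, hL, rfl⟩
    have := finrank_mul_finrank F K L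
    rw [hL, hl, mul_one] at this
    exact this.symm
  · rintro _ ⟨L, hL, rfl⟩ h0
    rw [Submodule.restrictScalars_eq_bot_iff] at h0
    rw [h0, finrank_bot] at hL
    omega
  · exact existsUnique_mem_desarguesianSpread
  · intro B hB
    exact finrank_of_mem_relationBlocks h3 (by simpa using hB)
  · intro G hG B hB
    exact finrank_inf_le_one_of_mem_relationBlocks h3 hG (by simpa using hB)
  · intro T hT hTG
    exact card_blocks_eq _ (fun B => by simp) hT hTG hv₀
  · exact Finset.nodup _
  · intro φ
    refine ⟨image_desarguesianSpread φ, ?_⟩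
    have hinj : Function.Injective
        (fun W : Submodule F V => W.map (φ.restrictScalars F : V →ₗ[F] V)) :=
      Submodule.map_injective_of_injective (φ.restrictScalars F).injective
    have h := Finset.map_val ⟨_, hinj⟩ (relationBlocks V 𝒮 k).toFinite.toFinset
    rw [Function.Embedding.coeFn_mk] at h
    rw [← h, Finset.val_inj]
    -- An injective map of a finite set into itself is onto, so stability of the blocks suffices.
    refine Finset.eq_of_subset_of_card_le (fun B hB => ?_) (Finset.card_map _).ge
    obtain ⟨B', hB', rfl⟩ := Finset.mem_map.1 hB
    rw [Set.Finite.mem_toFinset] at hB' ⊢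
    exact map_mem_relationBlocks hB' φ

end Design

/-! ### Fields of multipliers and orbits of `Kˣ` on subspaces -/

section Multiplier

variable {F K : Type*} [Field F] [Field K] [Algebra F K]

/-- A subfield with `n` elements consists of roots of `X^n - X`, which has at most `n` roots. Hence
its size determines it. -/
theorem IntermediateField.mem_iff_pow_natCard_eq [Finite K] (E : IntermediateField F K) (x : K) :
    x ∈ E ↔ x ^ Nat.card E = x := by
  classical
  have := Fintype.ofFinite E
  have h1 : ∀ x ∈ E, x ^ Nat.card E = x := by
    intro x hx
    have h2 := FiniteField.pow_card (⟨x, hx⟩ : E)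
    rw [← Nat.card_eq_fintype_card] at h2
    exact congrArg Subtype.val h2
  refine ⟨h1 x, fun hx => ?_⟩
  have hc : 1 < Nat.card E := Finite.one_lt_card
  have hne : (Polynomial.X ^ Nat.card E - Polynomial.X : Polynomial K) ≠ 0 :=
    FiniteField.X_pow_card_sub_X_ne_zero K hc
  have hroot : ∀ y : K, y ∈ (Polynomial.X ^ Nat.card E - Polynomial.X : Polynomial K).roots.toFinset
      ↔ y ^ Nat.card E = y := by
    intro y
    rw [Multiset.mem_toFinset, Polynomial.mem_roots hne]
    simp [sub_eq_zero]
  have hsub : (Set.toFinite (E : Set K)).toFinset ⊆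
      (Polynomial.X ^ Nat.card E - Polynomial.X : Polynomial K).roots.toFinset := by
    intro y hy
    exact (hroot y).2 (h1 y (by simpa using hy))
  have hle : (Polynomial.X ^ Nat.card E - Polynomial.X : Polynomial K).roots.toFinset.card ≤
      (Set.toFinite (E : Set K)).toFinset.card := by
    refine (Multiset.toFinset_card_le _).trans ((Polynomial.card_roots' _).trans ?_)
    rw [FiniteField.X_pow_card_sub_X_natDegree_eq K hc, ← Set.ncard_eq_toFinset_card]
    exact (Nat.card_coe_set_eq (E : Set K)).le
  have hmem := (hroot x).2 hx
  rw [← Finset.eq_of_subset_of_card_le hsub hle] at hmem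
  simpa using hmem

variable [FiniteDimensional F K]

theorem Submodule.units_smul_eq_iff (S : Submodule F K) (a : Kˣ) :
    a • S = S ↔ ∀ s ∈ S, (a : K) * s ∈ S := by
  constructor
  · intro h s hs
    have h1 : a • s ∈ a • S := ⟨s, hs, rfl⟩
    rw [h] at h1
    exact h1
  · intro h
    refine Submodule.eq_of_le_of_finrank_eq ?_ (finrank_units_smul a S)
    rintro _ ⟨s, hs, rfl⟩
    exact h s hs

/-- The subfield of the elements of `K` that map the `F`-subspace `S` to itself. -/
def multiplierField (S : Submodule F K) : IntermediateField F K where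
  carrier := {a | ∀ s ∈ S, a * s ∈ S}
  mul_mem' ha hb s hs := by
    rw [mul_assoc]
    exact ha _ (hb s hs)
  add_mem' ha hb s hs := by
    rw [add_mul]
    exact add_mem (ha s hs) (hb s hs)
  algebraMap_mem' r s hs := by
    rw [← Algebra.smul_def]
    exact S.smul_mem r hs
  inv_mem' a ha := by
    intro s hs
    rcases eq_or_ne a 0 with rfl | h0
    · simp
    -- By finite dimension, a nonzero multiplier maps `S` onto itself, so its inverse is a
    -- multiplier too.
    · have h1 : Units.mk0 a h0 • S = S := (S.units_smul_eq_iff _).2 ha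
      rw [← h1] at hs
      obtain ⟨t, ht, rfl⟩ := hs
      change a⁻¹ * (a * t) ∈ S
      rwa [inv_mul_cancel_left₀ h0]

theorem mem_multiplierField {S : Submodule F K} {a : K} :
    a ∈ multiplierField S ↔ ∀ s ∈ S, a * s ∈ S := Iff.rfl

theorem finrank_multiplierField_dvd (S : Submodule F K) :
    finrank F (multiplierField S) ∣ finrank F S := by
  let T : Submodule (multiplierField S) K :=
    { S.toAddSubmonoid with smul_mem' := fun a s hs => a.2 s hs }
  have h := finrank_mul_finrank F (multiplierField S) T
  exact ⟨_, h.symm⟩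

theorem natCard_stabilizer (S : Submodule F K) [Finite K] :
    Nat.card (MulAction.stabilizer Kˣ S) = Nat.card F ^ finrank F (multiplierField S) - 1 := by
  rw [← Module.natCard_eq_pow_finrank (K := F), ← Nat.card_units]
  exact Nat.card_congr
    { toFun := fun a => Units.mk0 ⟨a.1, (S.units_smul_eq_iff a.1).1 a.2⟩
        (fun h => a.1.ne_zero (congrArg Subtype.val h))
      invFun := fun x => ⟨Units.map (multiplierField S).val.toMonoidHom x,
        (S.units_smul_eq_iff _).2 (mem_multiplierField.1 x.1.2)⟩
      left_inv := fun a => by ext; rfl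
      right_inv := fun x => by ext; rfl }

theorem natCard_orbit_mul (S : Submodule F K) [Finite K] :
    Nat.card (MulAction.orbit Kˣ S) * (Nat.card F ^ finrank F (multiplierField S) - 1) =
      Nat.card K - 1 := by
  rw [← natCard_stabilizer, ← Nat.card_prod, ← Nat.card_units]
  exact Nat.card_congr (MulAction.orbitProdStabilizerEquivGroup Kˣ S)

theorem IntermediateField.eq_of_finrank_eq [Finite K] {E E' : IntermediateField F K}
    (h : finrank F E = finrank F E') : E = E' := by
  have h1 : Nat.card E = Nat.card E' := by
    rw [Module.natCard_eq_pow_finrank (K := F), h, ← Module.natCard_eq_pow_finrank]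
  ext x
  rw [E.mem_iff_pow_natCard_eq, E'.mem_iff_pow_natCard_eq, h1]

/-- For a nonzero `s` in `S`, the multiples of `s` by multipliers lie in `S` and already have full
dimension. -/
theorem exists_units_smul_multiplierField {S : Submodule F K} (hS : S ≠ ⊥)
    (h : finrank F (multiplierField S) = finrank F S) :
    ∃ a : Kˣ, a • (multiplierField S).toSubalgebra.toSubmodule = S := by
  obtain ⟨s, hs, hs0⟩ := S.exists_mem_ne_zero_of_ne_bot hS
  refine ⟨Units.mk0 s hs0, Submodule.eq_of_le_of_finrank_eq ?_ ?_⟩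
  · rintro _ ⟨x, hx, rfl⟩
    change s * x ∈ S
    rw [mul_comm]
    exact hx s hs
  · rw [finrank_units_smul, ← h]
    rfl

theorem multiplierField_toSubmodule (E : IntermediateField F K) :
    multiplierField E.toSubalgebra.toSubmodule = E := by
  ext x
  rw [mem_multiplierField]
  exact ⟨fun h => by simpa using h 1 E.one_mem, fun h s hs => E.mul_mem h hs⟩

/-- All `r`-dimensional subspaces with an `r`-dimensional field of multipliers are in one orbit. -/
theorem mem_orbit_of_finrank_multiplierField_eq [Finite K] {S S' : Submodule F K} {r : ℕ}
    (hr : r ≠ 0) (hS : finrank F S = r) (hS' : finrank F S' = r)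
    (h : finrank F (multiplierField S) = r) (h' : finrank F (multiplierField S') = r) :
    S' ∈ MulAction.orbit Kˣ S := by
  have hb : S ≠ ⊥ := by
    rintro rfl
    exact hr (hS.symm.trans (finrank_bot F K))
  have hb' : S' ≠ ⊥ := by
    rintro rfl
    exact hr (hS'.symm.trans (finrank_bot F K))
  obtain ⟨a, ha⟩ := exists_units_smul_multiplierField hb (h.trans hS.symm)
  obtain ⟨a', ha'⟩ := exists_units_smul_multiplierField hb' (h'.trans hS'.symm)
  rw [IntermediateField.eq_of_finrank_eq (h'.trans h.symm)] at ha'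
  refine ⟨a' * a⁻¹, ?_⟩
  change (a' * a⁻¹) • S = S'
  rw [← ha', mul_smul, inv_smul_eq_iff.2 ha.symm]

theorem exists_intermediateField_finrank_eq [Finite F] {r : ℕ} [NeZero r]
    (hr : r ∣ finrank F K) : ∃ E : IntermediateField F K, finrank F E = r := by
  obtain ⟨p, hp⟩ := CharP.exists F
  have : Fact p.Prime := ⟨CharP.char_is_prime F p⟩
  have : Finite K := Module.finite_of_finite F
  obtain ⟨f⟩ := FiniteField.nonempty_algHom_of_finrank_dvd (F := F)
    (K := FiniteField.Extension F p r) (L := K) (by rwa [FiniteField.finrank_extension])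
  refine ⟨f.fieldRange, ?_⟩
  refine Eq.trans ?_ (FiniteField.finrank_extension F p r)
  exact (LinearEquiv.finrank_eq (AlgEquiv.ofInjectiveField f).toLinearEquiv).symm

/-- If `p` divides the degree, the subfield of degree `p` is its own field of multipliers. Otherwise
any `p`-dimensional subspace works: the multiplier degree divides both `p` and the degree of `K`, so
it is 1. -/
theorem exists_submodule_finrank_multiplierField_eq_gcd [Finite F] {p : ℕ} (hp : p.Prime)
    (hle : p ≤ finrank F K) : ∃ S : Submodule F K, finrank F S = p ∧
      finrank F (multiplierField S) = p.gcd (finrank F K) := by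
  by_cases hd : p ∣ finrank F K
  · have : NeZero p := ⟨hp.ne_zero⟩
    obtain ⟨E, hE⟩ := exists_intermediateField_finrank_eq hd
    refine ⟨E.toSubalgebra.toSubmodule, hE, ?_⟩
    rw [multiplierField_toSubmodule, hE, Nat.gcd_eq_left hd]
  · obtain ⟨v, hv⟩ := exists_linearIndependent_of_le_finrank hle
    refine ⟨Submodule.span F (Set.range v), ?_, ?_⟩
    · rw [finrank_span_eq_card hv, Fintype.card_fin]
    · have h1 := finrank_multiplierField_dvd (Submodule.span F (Set.range v))
      rw [finrank_span_eq_card hv, Fintype.card_fin] at h1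
      rw [((Nat.Prime.coprime_iff_not_dvd hp).2 hd).gcd_eq_one]
      refine ((Nat.dvd_prime hp).1 h1).resolve_right fun h2 => hd ?_
      rw [← h2]
      exact ⟨_, (finrank_mul_finrank F _ K).symm⟩

theorem natCard_submodule_finrank_eq [Finite F] {r : ℕ} (hr : r ≤ finrank F K) :
    Nat.card {S : Submodule F K // finrank F S = r} * independentCount (Nat.card F) r r =
      independentCount (Nat.card F) (finrank F K) r := by
  have : Finite K := Module.finite_of_finite F
  have : Finite (Submodule F K) := Finite.of_injective _ SetLike.coe_injective
  rw [← natCard_linearIndependent hr]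
  symm
  refine natCard_eq_mul_of_fiber (fun v => ⟨Submodule.span F (Set.range v.1), by
    rw [finrank_span_eq_card v.2, Fintype.card_fin]⟩) fun S => ?_
  rw [← natCard_span_range_eq le_rfl S.1 S.2]
  exact Nat.card_congr
    { toFun := fun v => ⟨v.1.1, congrArg Subtype.val v.2⟩
      invFun := fun v => ⟨⟨v.1, by
        rw [linearIndependent_iff_card_eq_finrank_span, Set.finrank, v.2, S.2, Fintype.card_fin]⟩,
        Subtype.ext v.2⟩
      left_inv := fun _ => rfl
      right_inv := fun _ => rfl }

/-- Unions of `w` orbits of `Kˣ` on `r`-dimensional subspaces with field of multipliers `F`. -/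
theorem exists_union_orbits [Finite F] {p : ℕ} (hp : p.Prime) (w : ℕ)
    (hw : (w : ℚ) * (((Nat.card F : ℚ) ^ finrank F K - 1)) ≤
      Nat.card {S : Submodule F K // finrank F S = p} * ((Nat.card F : ℚ) - 1)) :
    ∃ 𝒮 : Set (Submodule F K), (∀ S ∈ 𝒮, finrank F S = p) ∧
      (∀ a : Kˣ, ∀ S ∈ 𝒮, a • S ∈ 𝒮) ∧
      Nat.card 𝒮 * (Nat.card F - 1) = w * (Nat.card K - 1) := by
  have : Finite K := Module.finite_of_finite F
  have : Finite (Submodule F K) := Finite.of_injective _ SetLike.coe_injective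
  have hq : 1 < Nat.card F := Finite.one_lt_card
  let f : Submodule F K → MulAction.orbitRel.Quotient Kˣ (Submodule F K) := Quotient.mk _
  have hf : ∀ S S', f S' = f S ↔ S' ∈ MulAction.orbit Kˣ S := fun S S' => Quotient.eq
  -- As `p` is prime, the multiplier degree is 1 or `p`: the orbit is either of the generic size
  -- `(|K| - 1)/(|F| - 1)` or short.
  let gen : Set (Submodule F K) := {S | finrank F S = p ∧ finrank F (multiplierField S) = 1}
  let sh : Set (Submodule F K) := {S | finrank F S = p ∧ finrank F (multiplierField S) = p}
  have hunion : ∀ Ω ⊆ f '' gen,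
      Nat.card (f ⁻¹' Ω) * (Nat.card F - 1) = Nat.card Ω * (Nat.card K - 1) := by
    intro Ω hΩ
    have h1 : Nat.card (f ⁻¹' Ω) = Nat.card Ω * ((Nat.card K - 1) / (Nat.card F - 1)) := by
      refine natCard_eq_mul_of_fiber (fun S => (⟨f S.1, S.2⟩ : Ω)) fun x => ?_
      obtain ⟨S, hS, hSx⟩ := hΩ x.2
      have h2 := natCard_orbit_mul S
      rw [hS.2, pow_one] at h2
      rw [← h2, Nat.mul_div_cancel _ (by omega)]
      exact Nat.card_congr
        { toFun := fun S' => ⟨S'.1.1, (hf _ _).1 ((congrArg Subtype.val S'.2).trans hSx.symm)⟩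
          invFun := fun S' => ⟨⟨S'.1, by
              change f S'.1 ∈ Ω
              rw [(hf _ _).2 S'.2, hSx]
              exact x.2⟩, Subtype.ext (((hf _ _).2 S'.2).trans hSx)⟩
          left_inv := fun _ => rfl
          right_inv := fun _ => rfl }
    -- Exactness of the division is read off from an orbit in `Ω`, so the empty case is separate.
    rcases Ω.eq_empty_or_nonempty with rfl | ⟨x, hx⟩
    · simp
    · obtain ⟨S, hS, -⟩ := hΩ hx
      have h2 := natCard_orbit_mul S
      rw [hS.2, pow_one] at h2
      rw [h1, mul_assoc, Nat.div_mul_cancel ⟨_, by rw [mul_comm]; exact h2.symm⟩]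
  have hsh : Nat.card sh * (Nat.card F ^ p - 1) ≤ Nat.card K - 1 := by
    rcases sh.eq_empty_or_nonempty with h0 | ⟨S, hS⟩
    · simp [h0]
    · rw [← natCard_orbit_mul S, hS.2]
      refine Nat.mul_le_mul_right _ (Nat.card_mono (Set.toFinite _) fun S' hS' => ?_)
      exact mem_orbit_of_finrank_multiplierField_eq hp.ne_zero hS.1 hS'.1 hS.2 hS'.2
  have htot : Nat.card {S : Submodule F K // finrank F S = p} ≤ Nat.card gen + Nat.card sh := by
    refine (Nat.card_mono (s := {S : Submodule F K | finrank F S = p}) (t := gen ∪ sh)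
      (Set.toFinite _) fun S hS => ?_).trans (Set.ncard_union_le gen sh)
    have h1 := finrank_multiplierField_dvd S
    rw [hS] at h1
    exact ((Nat.dvd_prime hp).1 h1).imp (fun h => ⟨hS, h⟩) (fun h => ⟨hS, h⟩)
  have hgen : Nat.card gen ≤ Nat.card (f ⁻¹' (f '' gen)) :=
    Nat.card_mono (Set.toFinite _) (Set.subset_preimage_image f gen)
  have hwle : w ≤ (f '' gen).ncard := by
    have h1 := hunion _ subset_rfl
    have hQ : Nat.card K = Nat.card F ^ finrank F K := Module.natCard_eq_pow_finrank
    have hQ1 : 1 < Nat.card K := Finite.one_lt_card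
    have hpq : Nat.card F < Nat.card F ^ p := by
      simpa using Nat.pow_lt_pow_right hq hp.one_lt
    have hw' : w * (Nat.card K - 1) ≤
        Nat.card {S : Submodule F K // finrank F S = p} * (Nat.card F - 1) := by
      rw [← Nat.cast_le (α := ℚ)]
      push_cast [Nat.cast_sub hQ1.le, Nat.cast_sub hq.le]
      rw [hQ]
      push_cast
      exact hw
    rw [Nat.card_coe_set_eq (f '' gen)] at h1
    -- With fewer than `w` generic orbits, the short subspaces would number at least `(|K| - 1)/(|F|
    -- - 1)`. They fill at most one orbit, of size `(|K| - 1)/(|F|^p - 1)`, which is smaller. So a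
    -- short orbit does not spoil the bound.
    by_contra! hlt
    have h2 := Nat.mul_le_mul_right (Nat.card K - 1) (Nat.succ_le_of_lt hlt)
    have h3 := Nat.mul_le_mul_right (Nat.card F - 1) (htot.trans (Nat.add_le_add_right hgen _))
    rw [add_mul, h1] at h3
    rw [Nat.succ_eq_add_one, add_mul, one_mul] at h2
    have h4 : Nat.card K - 1 ≤ Nat.card sh * (Nat.card F - 1) := by omega
    have hpos : 0 < Nat.card sh := Nat.pos_of_ne_zero fun h0 => by
      rw [h0, zero_mul] at h4
      omega
    have h5 := Nat.le_of_mul_le_mul_left (hsh.trans h4) hpos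
    omega
  obtain ⟨Ω, hΩ, hcard⟩ := Set.exists_subset_card_eq hwle
  refine ⟨f ⁻¹' Ω, ?_, ?_, ?_⟩
  · intro S hS
    obtain ⟨S', hS', h⟩ := hΩ hS
    obtain ⟨a, rfl⟩ := (hf _ _).1 h.symm
    exact (finrank_units_smul a S').trans hS'.1
  · intro a S hS
    change f (a • S) ∈ Ω
    rw [(hf S (a • S)).2 ⟨a, rfl⟩]
    exact hS
  · rw [hunion Ω hΩ, Nat.card_coe_set_eq, hcard]

end Multiplier

/-! ### The two choices of `𝒮` and the resulting parameters -/

theorem mainTheorem5 {F : Type*} {K : Type*} {V : Type*} [Field F] [Fintype F] [Field K]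
    [Algebra F K] [AddCommGroup V] [Module F V] [Module K V] [IsScalarTower F K V]
    (q m l k : ℕ) (hq : Fintype.card F = q) (hl : Module.finrank F K = l)
    (hm : Module.finrank K V = m) (hk : 3 ≤ k) (hkml : k ≤ min (m + 1) l) :
    (k = 3 → ∀ w : ℕ,
      w ≤ ⌊(((q : ℚ) ^ (l - 1) - 1) * ((q : ℚ) ^ (l - 2) - 1)) /
            (((q : ℚ) ^ 3 - 1) * ((q : ℚ) ^ 2 - 1))⌋₊ →
      ∃ lam : ℕ, (lam : ℚ) = w * ((q : ℚ) ^ 2 + q + 1) * ((q : ℚ) ^ 3 - q) ∧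
        ∃ ℬ : Multiset (Submodule F V),
          IsSimpleQGDD (m * l) l k lam (desarguesianSpread F K V) ℬ ∧
          AdmitsGL F K (desarguesianSpread F K V) ℬ) ∧
    (k = 4 ∨ k = 5 ∨ k = 6 →
      ∃ lam : ℕ, (lam : ℚ) =
          (((q : ℚ) ^ k - 1) * ((q : ℚ) ^ k - q) *
            ∏ j ∈ Finset.Icc 2 (k - 2), ((q : ℚ) ^ (m * l) - (q : ℚ) ^ (j * l))) /
          (((q : ℚ) ^ (Nat.gcd 3 l) - 1) *
            ∏ j ∈ Finset.Icc 3 (k - 1), ((q : ℚ) ^ k - (q : ℚ) ^ j)) ∧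
        ∃ ℬ : Multiset (Submodule F V),
          IsSimpleQGDD (m * l) l k lam (desarguesianSpread F K V) ℬ ∧
          AdmitsGL F K (desarguesianSpread F K V) ℬ) := by
  obtain ⟨hkm, hkl⟩ := le_min_iff.1 hkml
  have : FiniteDimensional F K := Module.finite_of_finrank_pos (by omega)
  have : FiniteDimensional K V := Module.finite_of_finrank_pos (by omega)
  have : Finite K := Module.finite_of_finite F
  have : Finite V := Module.finite_of_finite K
  rw [← Nat.card_eq_fintype_card] at hq
  have hq1 : 1 < q := hq ▸ Finite.one_lt_card
  have hQ : Nat.card K = q ^ l := by rw [Module.natCard_eq_pow_finrank (K := F), hq, hl]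
  have hQ1 : 1 < Nat.card K := Finite.one_lt_card
  have hq1' : (1 : ℚ) < q := mod_cast hq1
  have hpow : ∀ n : ℕ, n ≠ 0 → (q : ℚ) ^ n - 1 ≠ 0 := fun n hn =>
    (sub_pos.2 (one_lt_pow₀ hq1' hn)).ne'
  have hql : (q : ℚ) ^ l - 1 ≠ 0 := hpow l (by omega)
  have hq0 : (q : ℚ) - 1 ≠ 0 := by simpa using hpow 1 one_ne_zero
  have hqq : (q : ℚ) ≠ 0 := by positivity
  constructor
  · rintro rfl w hw
    have hfl : (w : ℚ) ≤ (((q : ℚ) ^ (l - 1) - 1) * ((q : ℚ) ^ (l - 2) - 1)) /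
        (((q : ℚ) ^ 3 - 1) * ((q : ℚ) ^ 2 - 1)) := by
      refine (Nat.le_floor_iff ?_).1 hw
      have h0 : ∀ n : ℕ, 0 ≤ (q : ℚ) ^ n - 1 := fun n => sub_nonneg.2 (one_le_pow₀ hq1'.le)
      exact div_nonneg (mul_nonneg (h0 _) (h0 _)) (mul_nonneg (h0 _) (h0 _))
    obtain ⟨𝒮, h3, hs, hcard⟩ := exists_union_orbits (F := F) (K := K) Nat.prime_three w (by
      have hM := natCard_submodule_finrank_eq (F := F) (K := K) (r := 3) (by omega)
      rw [hq, hl] at hM ⊢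
      have hM' := congrArg (Nat.cast : ℕ → ℚ) hM
      rw [Nat.cast_mul, cast_independentCount hq1 le_rfl, cast_independentCount hq1 hkl] at hM'
      simp only [Finset.prod_range_succ, Finset.prod_range_zero, pow_zero, pow_one, one_mul] at hM'
      generalize (Nat.card {S : Submodule F K // finrank F S = 3} : ℚ) = M at *
      obtain ⟨n, rfl⟩ : ∃ n, l = n + 2 := ⟨l - 2, by omega⟩
      rw [show n + 2 - 1 = n + 1 by omega, show n + 2 - 2 = n by omega,
        le_div_iff₀ (mul_pos (sub_pos.2 (one_lt_pow₀ hq1' (by norm_num)))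
          (sub_pos.2 (one_lt_pow₀ hq1' (by norm_num))))] at hfl
      have hpos : 0 < ((q : ℚ) ^ 3 - 1) * ((q : ℚ) ^ 2 - 1) :=
        mul_pos (sub_pos.2 (one_lt_pow₀ hq1' (by norm_num)))
          (sub_pos.2 (one_lt_pow₀ hq1' (by norm_num)))
      have hQpos : 0 ≤ (q : ℚ) ^ (n + 2) - 1 := sub_nonneg.2 (one_le_pow₀ hq1'.le)
      have hMeq : M * (q - 1) * (((q : ℚ) ^ 3 - 1) * ((q : ℚ) ^ 2 - 1)) =
          (q ^ (n + 2) - 1) * ((q ^ (n + 1) - 1) * (q ^ n - 1)) := by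
        -- Both products of the Gaussian binomial coefficient contain the factor `q * q^2`.
        apply mul_left_cancel₀ (pow_ne_zero 3 hqq)
        linear_combination hM'
      refine le_of_mul_le_mul_right ?_ hpos
      rw [hMeq]
      have := mul_le_mul_of_nonneg_left hfl hQpos
      linarith)
    obtain ⟨lam, hlam, hℬ⟩ := exists_isSimpleQGDD (V := V) hl hm h3 hs le_rfl (by omega)
    refine ⟨lam, ?_, hℬ⟩
    rw [hq] at hlam hcard
    have hcard' : (Nat.card 𝒮 : ℚ) * (q - 1) = w * (q ^ l - 1) := by
      have := congrArg (Nat.cast : ℕ → ℚ) hcard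
      rw [hQ] at this
      push_cast [Nat.cast_sub (Nat.one_le_pow l q (by omega)), Nat.cast_sub hq1.le] at this
      exact this
    -- For `k = 3` both products are empty, and the size of `𝒮` contributes `w/(q - 1)`, which turns
    -- `q^3 - 1` into `w (q^2 + q + 1)`.
    rw [hlam, show Finset.Icc 2 (3 - 2) = ∅ by decide, show Finset.Icc 3 (3 - 1) = ∅ by decide,
      eq_div_of_mul_eq hq0 hcard', Finset.prod_empty, Finset.prod_empty]
    field_simp
    ring
  · intro _
    obtain ⟨S, hS, hd⟩ := exists_submodule_finrank_multiplierField_eq_gcd (F := F) (K := K)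
      Nat.prime_three (by omega)
    -- A single orbit, of size `(q^l - 1)/(q^gcd(3, l) - 1)`, accounts for the gcd in the
    -- denominator.
    obtain ⟨lam, hlam, hℬ⟩ := exists_isSimpleQGDD (V := V) (𝒮 := MulAction.orbit Kˣ S) hl hm
      (by rintro _ ⟨a, rfl⟩; exact (finrank_units_smul a S).trans hS)
      (by rintro a _ ⟨b, rfl⟩; exact ⟨a * b, mul_smul a b S⟩) hk (by omega)
    refine ⟨lam, ?_, hℬ⟩
    have hcard := natCard_orbit_mul S
    rw [hd, hl, hq, hQ] at hcard
    have hcard' : (Nat.card (MulAction.orbit Kˣ S) : ℚ) * (q ^ (Nat.gcd 3 l) - 1) = q ^ l - 1 := by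
      have := congrArg (Nat.cast : ℕ → ℚ) hcard
      push_cast [Nat.cast_sub (Nat.one_le_pow l q (by omega)),
        Nat.cast_sub (Nat.one_le_pow (Nat.gcd 3 l) q (by omega))] at this
      exact this
    have hg : (q : ℚ) ^ (Nat.gcd 3 l) - 1 ≠ 0 :=
      hpow _ (Nat.gcd_pos_of_pos_left _ (by norm_num)).ne'
    rw [hlam, hq, eq_div_of_mul_eq hg hcard', div_right_comm, div_self hql, div_mul_div_comm,
      one_mul]
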